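/- Let $K$ be a field of characteristic zero, $d$ a natural number and $A=(a_{ij})$ a $d\times d$ matrix over $K$. For $1\le i\le d$ put $L_i=a_{i1}X_1+\dots+a_{id}X_d$, $H_i=L_i^3$ and $F_i=X_i+H_i$ in $K[X_1,\dots,X_d]$, and let $JH=(\partial H_i/\partial X_j)_{1\le i,j\le d}$ be the Jacobian matrix of $H=(H_1,\dots,H_d)$. For each $i$ define polynomials $P_j^i\in K[X_1,\dots,X_d]$ by $P_0^i=X_i$, $P_1^i=H_i$ and $$P_j^i(X_1,\dots,X_d)=P_{j-1}^i(F_1,\dots,F_d)-P_{j-1}^i(X_1,\dots,X_d)\qquad(j\ge 2).$$ If $(JH)^3=0$, then for every $i=1,\dots,d$: (a) $\deg P_j^i\le 9$ for $j=2,3,4$; (b) $P_5^i=0$; (c) $P_4^i=6\sum_{j,k,l=1}^d a_{ij}a_{ik}a_{il}\,L_j^3L_k^3L_l^3$. Here $\deg$ is the total degree, and the zero polynomial satisfies every degree bound. -/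

import Mathlib

noncomputable section

namespace Druzkowski

open MvPolynomial

variable {K : Type*} [Field K] {d : ℕ}

/-- The linear form `L_i = a_{i1} X_1 + ⋯ + a_{id} X_d`. -/
def linForm (A : Matrix (Fin d) (Fin d) K) (i : Fin d) : MvPolynomial (Fin d) K :=
  ∑ j, C (A i j) * X j

/-- The cubic map `H = (L_1 ^ 3, …, L_d ^ 3)`. -/
def cubicPart (A : Matrix (Fin d) (Fin d) K) (i : Fin d) : MvPolynomial (Fin d) K :=
  linForm A i ^ 3

/-- The Jacobian matrix `(∂H_i/∂X_j)` of a polynomial map. -/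
def jacobian (H : Fin d → MvPolynomial (Fin d) K) :
    Matrix (Fin d) (Fin d) (MvPolynomial (Fin d) K) :=
  Matrix.of fun i j => pderiv j (H i)

/-- The polynomial map `F = Id + H`. -/
def idAdd (H : Fin d → MvPolynomial (Fin d) K) (i : Fin d) : MvPolynomial (Fin d) K :=
  X i + H i

/-- The sequence `P_0^i = X_i`, `P_1^i = H_i`,
`P_j^i = P_{j-1}^i(F_1, …, F_d) - P_{j-1}^i(X_1, …, X_d)` for `j ≥ 2`, where `F = Id + H`;
`bind₁ F` is the substitution `X_k ↦ F_k`. -/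
def pSeq (H : Fin d → MvPolynomial (Fin d) K) (i : Fin d) : ℕ → MvPolynomial (Fin d) K
  | 0 => X i
  | 1 => H i
  | j + 2 => bind₁ (idAdd H) (pSeq H i (j + 1)) - pSeq H i (j + 1)

end Druzkowski

end

namespace Druzkowski

open MvPolynomial

variable {K : Type*} [Field K] {d : ℕ}

/-- The form `M_i = L_i(H) = a_{i1} L_1 ^ 3 + ⋯ + a_{id} L_d ^ 3`. -/
noncomputable def linFormCubic (A : Matrix (Fin d) (Fin d) K) (i : Fin d) :
    MvPolynomial (Fin d) K :=
  ∑ j, C (A i j) * linForm A j ^ 3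

/-- The derivation `∑ k, H_k ∂/∂X_k`. -/
noncomputable def cubicDerivation (A : Matrix (Fin d) (Fin d) K) :
    Derivation K (MvPolynomial (Fin d) K) (MvPolynomial (Fin d) K) :=
  mkDerivation K (cubicPart A)

theorem pderiv_linForm (A : Matrix (Fin d) (Fin d) K) (i j : Fin d) :
    pderiv j (linForm A i) = C (A i j) := by
  simp [linForm, Derivation.leibniz, pderiv_X, Pi.single_apply]

theorem jacobian_cubicPart_apply (A : Matrix (Fin d) (Fin d) K) (i j : Fin d) :
    jacobian (cubicPart A) i j = 3 * linForm A i ^ 2 * C (A i j) := by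
  simp [jacobian, cubicPart, Derivation.leibniz_pow, pderiv_linForm, mul_assoc]

theorem jacobian_cubicPart_mulVec (A : Matrix (Fin d) (Fin d) K)
    (v : Fin d → MvPolynomial (Fin d) K) (i : Fin d) :
    (jacobian (cubicPart A)).mulVec v i = 3 * linForm A i ^ 2 * ∑ j, C (A i j) * v j := by
  simp [Matrix.mulVec, dotProduct, jacobian_cubicPart_apply, Finset.mul_sum, mul_assoc]

theorem cubicDerivation_linForm (A : Matrix (Fin d) (Fin d) K) (i : Fin d) :
    cubicDerivation A (linForm A i) = linFormCubic A i := by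
  simp [linForm, cubicDerivation, linFormCubic, cubicPart, Derivation.leibniz,
    mkDerivation_X]

theorem bind₁_linForm (A : Matrix (Fin d) (Fin d) K) (i : Fin d) :
    bind₁ (idAdd (cubicPart A)) (linForm A i) = linForm A i + linFormCubic A i := by
  simp [linForm, linFormCubic, idAdd, cubicPart, mul_add, Finset.sum_add_distrib]

theorem totalDegree_linForm_le (A : Matrix (Fin d) (Fin d) K) (i : Fin d) :
    (linForm A i).totalDegree ≤ 1 :=
  totalDegree_finsetSum_le fun j _ =>
    (totalDegree_mul _ _).trans (by simp [totalDegree_C, totalDegree_X])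

theorem totalDegree_linFormCubic_le (A : Matrix (Fin d) (Fin d) K) (i : Fin d) :
    (linFormCubic A i).totalDegree ≤ 3 :=
  totalDegree_finsetSum_le fun j _ => by
    have h₁ := totalDegree_mul (C (A i j)) (linForm A j ^ 3)
    have h₂ := totalDegree_pow (linForm A j) 3
    have h₃ := totalDegree_linForm_le A j
    rw [totalDegree_C] at h₁
    omega

theorem linFormCubic_pow_three (A : Matrix (Fin d) (Fin d) K) (i : Fin d) :
    linFormCubic A i ^ 3 = ∑ j, ∑ k, ∑ l, C (A i j * A i k * A i l) *
      (linForm A j ^ 3 * linForm A k ^ 3 * linForm A l ^ 3) := by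
  rw [pow_succ, pow_two, linFormCubic, Finset.sum_mul_sum, Finset.sum_mul]
  refine Finset.sum_congr rfl fun j _ => ?_
  rw [Finset.sum_mul_sum]
  refine Finset.sum_congr rfl fun k _ => Finset.sum_congr rfl fun l _ => ?_
  simp only [C_mul]
  ring

theorem pSeq_two (A : Matrix (Fin d) (Fin d) K) (i : Fin d) :
    pSeq (cubicPart A) i 2 =
    3 * linForm A i ^ 2 * linFormCubic A i + 3 * linForm A i * linFormCubic A i ^ 2 +
      linFormCubic A i ^ 3 := by
  rw [pSeq, pSeq, cubicPart, map_pow, bind₁_linForm]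
  ring

/-- Apply `(JH) ^ 3 = 0` to the vector `X`: successive images are `3 L_k ^ 3`, `9 L_k ^ 2 M_k`, and
finally `27 L_i ^ 2` times the sum in question. -/
theorem sum_linForm_sq_mul_linFormCubic [CharZero K] {A : Matrix (Fin d) (Fin d) K}
    (hJ : jacobian (cubicPart A) ^ 3 = 0) (i : Fin d) :
    ∑ j, C (A i j) * (linForm A j ^ 2 * linFormCubic A j) = 0 := by
  have h : (jacobian (cubicPart A) ^ 3).mulVec X i = 0 := by simp [hJ]
  have h₁ : (jacobian (cubicPart A)).mulVec X = fun k => 3 * linForm A k ^ 3 := by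
    funext k
    rw [jacobian_cubicPart_mulVec, ← linForm]
    ring
  have h₂ : (jacobian (cubicPart A)).mulVec (fun k => 3 * linForm A k ^ 3) =
      fun k => 9 * (linForm A k ^ 2 * linFormCubic A k) := by
    funext k
    rw [jacobian_cubicPart_mulVec, linFormCubic]
    simp only [mul_left_comm _ (3 : MvPolynomial (Fin d) K), ← Finset.mul_sum]
    ring
  rw [pow_succ, pow_two, ← Matrix.mulVec_mulVec, ← Matrix.mulVec_mulVec, h₁, h₂,
    jacobian_cubicPart_mulVec] at h
  simp only [mul_left_comm _ (9 : MvPolynomial (Fin d) K), ← Finset.mul_sum] at h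
  -- The factor `L_i ^ 2` can be cancelled unless `L_i = 0`, and then row `i` of `A` is zero.
  by_cases hL : linForm A i = 0
  · have hA : ∀ j, C (A i j) = (0 : MvPolynomial (Fin d) K) := fun j => by
      rw [← pderiv_linForm, hL, map_zero]
    simp only [hA, zero_mul, Finset.sum_const_zero]
  · simpa [hL] using h

theorem cubicDerivation_linFormCubic [CharZero K] {A : Matrix (Fin d) (Fin d) K}
    (hJ : jacobian (cubicPart A) ^ 3 = 0) (i : Fin d) :
    cubicDerivation A (linFormCubic A i) = 0 := by
  have h : cubicDerivation A (linFormCubic A i) =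
      3 * ∑ j, C (A i j) * (linForm A j ^ 2 * linFormCubic A j) := by
    conv_lhs => rw [linFormCubic]
    rw [map_sum, Finset.mul_sum]
    refine Finset.sum_congr rfl fun j _ => ?_
    rw [Derivation.leibniz, Derivation.leibniz_pow, cubicDerivation_linForm, derivation_C]
    simp only [smul_eq_mul, nsmul_eq_mul, mul_zero, add_zero, Nat.cast_ofNat]
    ring
  rw [h, sum_linForm_sq_mul_linFormCubic hJ, mul_zero]

/-- The derivation sends `L_j` to `M_j` and kills `M_j`, so applying it to the previous identity
trades a factor `L_j` for `M_j`. -/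
theorem sum_linForm_mul_linFormCubic_sq [CharZero K] {A : Matrix (Fin d) (Fin d) K}
    (hJ : jacobian (cubicPart A) ^ 3 = 0) (i : Fin d) :
    ∑ j, C (A i j) * (linForm A j * linFormCubic A j ^ 2) = 0 := by
  have h := congrArg (cubicDerivation A) (sum_linForm_sq_mul_linFormCubic hJ i)
  have h' : cubicDerivation A (∑ j, C (A i j) * (linForm A j ^ 2 * linFormCubic A j)) =
      2 * ∑ j, C (A i j) * (linForm A j * linFormCubic A j ^ 2) := by
    rw [map_sum, Finset.mul_sum]
    refine Finset.sum_congr rfl fun j _ => ?_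
    rw [Derivation.leibniz, Derivation.leibniz, Derivation.leibniz_pow,
      cubicDerivation_linForm, cubicDerivation_linFormCubic hJ, derivation_C]
    simp only [smul_eq_mul, nsmul_eq_mul, mul_zero, add_zero, zero_add, Nat.cast_ofNat]
    ring
  rw [h', map_zero] at h
  simpa using h

theorem sum_linFormCubic_pow_three [CharZero K] {A : Matrix (Fin d) (Fin d) K}
    (hJ : jacobian (cubicPart A) ^ 3 = 0) (i : Fin d) :
    ∑ j, C (A i j) * linFormCubic A j ^ 3 = 0 := by
  -- One more application of the derivation removes the last factor `L_j`.
  rw [← map_zero (cubicDerivation A), ← sum_linForm_mul_linFormCubic_sq hJ i, map_sum]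
  refine Finset.sum_congr rfl fun j _ => ?_
  rw [Derivation.leibniz, Derivation.leibniz, Derivation.leibniz_pow,
    cubicDerivation_linForm, cubicDerivation_linFormCubic hJ, derivation_C]
  simp only [smul_eq_mul, smul_zero, mul_zero, add_zero, zero_add]
  ring

/-- The forms `M_i = L_i(H)` are invariant under the substitution `X ↦ X + H`. -/
theorem bind₁_linFormCubic [CharZero K] {A : Matrix (Fin d) (Fin d) K}
    (hJ : jacobian (cubicPart A) ^ 3 = 0) (i : Fin d) :
    bind₁ (idAdd (cubicPart A)) (linFormCubic A i) = linFormCubic A i := by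
  -- Expansion of `∑ a_ij (L_j + M_j) ^ 3`; the three sums after `M_i` all vanish.
  have h : bind₁ (idAdd (cubicPart A)) (linFormCubic A i) =
      linFormCubic A i + 3 * ∑ j, C (A i j) * (linForm A j ^ 2 * linFormCubic A j) +
        3 * ∑ j, C (A i j) * (linForm A j * linFormCubic A j ^ 2) +
        ∑ j, C (A i j) * linFormCubic A j ^ 3 := by
    conv_lhs => rw [linFormCubic]
    conv_rhs => enter [1, 1, 1]; rw [linFormCubic]
    simp only [map_sum, Finset.mul_sum, ← Finset.sum_add_distrib]
    refine Finset.sum_congr rfl fun j _ => ?_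
    rw [map_mul, map_pow, bind₁_C_right, bind₁_linForm]
    ring
  rw [h, sum_linForm_sq_mul_linFormCubic hJ, sum_linForm_mul_linFormCubic_sq hJ,
    sum_linFormCubic_pow_three hJ]
  ring

theorem pSeq_three [CharZero K] {A : Matrix (Fin d) (Fin d) K}
    (hJ : jacobian (cubicPart A) ^ 3 = 0) (i : Fin d) :
    pSeq (cubicPart A) i 3 =
    6 * linForm A i * linFormCubic A i ^ 2 + 6 * linFormCubic A i ^ 3 := by
  rw [pSeq, pSeq_two]
  simp only [map_add, map_mul, map_pow, map_ofNat, bind₁_linForm, bind₁_linFormCubic hJ]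
  ring

theorem pSeq_four [CharZero K] {A : Matrix (Fin d) (Fin d) K}
    (hJ : jacobian (cubicPart A) ^ 3 = 0) (i : Fin d) :
    pSeq (cubicPart A) i 4 = 6 * linFormCubic A i ^ 3 := by
  rw [pSeq, pSeq_three hJ]
  simp only [map_add, map_mul, map_pow, map_ofNat, bind₁_linForm, bind₁_linFormCubic hJ]
  ring

theorem pSeq_five [CharZero K] {A : Matrix (Fin d) (Fin d) K}
    (hJ : jacobian (cubicPart A) ^ 3 = 0) (i : Fin d) :
    pSeq (cubicPart A) i 5 = 0 := by
  rw [pSeq, pSeq_four hJ]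
  simp only [map_mul, map_pow, map_ofNat, bind₁_linFormCubic hJ, sub_self]

theorem totalDegree_ofNat_mul_le (n a b : ℕ) [n.AtLeastTwo] (A : Matrix (Fin d) (Fin d) K)
    (i : Fin d) (h : a + 3 * b ≤ 9) :
    ((OfNat.ofNat n : MvPolynomial (Fin d) K) *
      (linForm A i ^ a * linFormCubic A i ^ b)).totalDegree ≤ 9 := by
  have h₀ : (OfNat.ofNat n : MvPolynomial (Fin d) K) = C (OfNat.ofNat n) := (map_ofNat C n).symm
  rw [h₀]
  have h₁ := totalDegree_mul (C (OfNat.ofNat n)) (linForm A i ^ a * linFormCubic A i ^ b)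
  have h₂ := totalDegree_mul (linForm A i ^ a) (linFormCubic A i ^ b)
  have h₃ := totalDegree_pow (linForm A i) a
  have h₄ := totalDegree_pow (linFormCubic A i) b
  have h₅ := Nat.mul_le_mul_left a (totalDegree_linForm_le A i)
  have h₆ := Nat.mul_le_mul_left b (totalDegree_linFormCubic_le A i)
  rw [totalDegree_C] at h₁
  omega

theorem totalDegree_linFormCubic_pow_three_le (A : Matrix (Fin d) (Fin d) K) (i : Fin d) :
    (linFormCubic A i ^ 3).totalDegree ≤ 9 :=
  (totalDegree_pow _ _).trans (Nat.mul_le_mul_left 3 (totalDegree_linFormCubic_le A i))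

theorem totalDegree_pSeq_le [CharZero K] {A : Matrix (Fin d) (Fin d) K}
    (hJ : jacobian (cubicPart A) ^ 3 = 0) (i : Fin d) {j : ℕ} (hj : j ∈ Finset.Icc 2 4) :
    (pSeq (cubicPart A) i j).totalDegree ≤ 9 := by
  have hadd {p q : MvPolynomial (Fin d) K} (hp : p.totalDegree ≤ 9) (hq : q.totalDegree ≤ 9) :
      (p + q).totalDegree ≤ 9 := (totalDegree_add p q).trans (max_le hp hq)
  have h₂₁ := totalDegree_ofNat_mul_le 3 2 1 A i (by norm_num)
  have h₁₂ := totalDegree_ofNat_mul_le 3 1 2 A i (by norm_num)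
  have h₁₂' := totalDegree_ofNat_mul_le 6 1 2 A i (by norm_num)
  have h₀₃ := totalDegree_ofNat_mul_le 6 0 3 A i (by norm_num)
  simp only [pow_zero, pow_one, one_mul, ← mul_assoc] at h₂₁ h₁₂ h₁₂' h₀₃
  rw [Finset.mem_Icc] at hj
  obtain ⟨hj₁, hj₂⟩ := hj
  interval_cases j
  · rw [pSeq_two]
    exact hadd (hadd h₂₁ h₁₂) (totalDegree_linFormCubic_pow_three_le A i)
  · rw [pSeq_three hJ]
    exact hadd h₁₂' h₀₃
  · rw [pSeq_four hJ]
    exact h₀₃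

end Druzkowski

theorem proposition3 {K : Type*} [Field K] [CharZero K] {d : ℕ}
    (A : Matrix (Fin d) (Fin d) K)
    (hJ : Druzkowski.jacobian (Druzkowski.cubicPart A) ^ 3 = 0) (i : Fin d) :
    (∀ j ∈ Finset.Icc 2 4, (Druzkowski.pSeq (Druzkowski.cubicPart A) i j).totalDegree ≤ 9) ∧
    Druzkowski.pSeq (Druzkowski.cubicPart A) i 5 = 0 ∧
    Druzkowski.pSeq (Druzkowski.cubicPart A) i 4 =
      6 * ∑ j, ∑ k, ∑ l, MvPolynomial.C (A i j * A i k * A i l) *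
        (Druzkowski.linForm A j ^ 3 * Druzkowski.linForm A k ^ 3 *
          Druzkowski.linForm A l ^ 3) :=
  ⟨fun _ hj => Druzkowski.totalDegree_pSeq_le hJ i hj, Druzkowski.pSeq_five hJ i, by
    rw [Druzkowski.pSeq_four hJ, Druzkowski.linFormCubic_pow_three]⟩
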